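/- Theorem (Wedderburn splitting). Let $k$ be a field with the discrete topology. A pseudocompact $k$-algebra is an associative unital topological $k$-algebra $A$ that has a basis of neighbourhoods of $0$ consisting of two-sided ideals of finite codimension with intersection $0$, and that is complete. Its Jacobson radical $J(A)$ is the intersection of its maximal closed left ideals (maximal among the proper closed left ideals); it is a closed two-sided ideal, and $A/J(A)$ carries the quotient topology. A topological algebra $R$ is topologically semisimple if every closed left ideal $I$ of $R$ has a closed left ideal $L$ with $R = I \oplus L$. A pseudocompact $k$-algebra $B$ is separable if, for every finite field extension $E$ of $k$, the algebra $B \,\widehat{\otimes}_k E$ is topologically semisimple, where $B \,\widehat{\otimes}_k E$ is the completed tensor product, that is, the inverse limit of the discrete algebras $B/I \otimes_k E$ over the open two-sided ideals $I$ of $B$. Let $A$ be a pseudocompact $k$-algebra such that $A/J(A)$ is separable. Then the canonical projection $\pi : A \to A/J(A)$ splits continuously as an algebra homomorphism: there is a continuous homomorphism of unital $k$-algebras $s : A/J(A) \to A$ with $\pi \circ s = \mathrm{id}$. Moreover, the image $S$ of $s$ is a closed subalgebra of $A$ and $A = S \oplus J(A)$ as $k$-vector spaces. -/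

import Mathlib

open scoped TensorProduct Topology

universe u v w

/-- A topological algebra `A` over the field `k` (taken with the discrete topology) is
*pseudocompact* if the open two-sided ideals of finite codimension form a basis of neighbourhoods
of `0`, their intersection is `0`, and `A` is complete (for the uniform structure of its additive
group). -/
class IsPseudocompactAlgebra (k : Type u) (A : Type v) [Field k] [Ring A] [Algebra k A]
    [TopologicalSpace A] [IsTopologicalRing A] : Prop where
  hasBasis_nhds_zero : (𝓝 (0 : A)).HasBasis
    (fun I : Ideal A => I.IsTwoSided ∧ IsOpen (I : Set A) ∧ FiniteDimensional k (A ⧸ I))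
    (fun I : Ideal A => (I : Set A))
  eq_zero_of_forall_mem : ∀ x : A,
    (∀ I : Ideal A, I.IsTwoSided → IsOpen (I : Set A) → FiniteDimensional k (A ⧸ I) → x ∈ I) →
      x = 0
  completeSpace : @CompleteSpace A (IsTopologicalAddGroup.rightUniformSpace A)

/-- `M` is a maximal closed left ideal: it is maximal among the proper closed left ideals.
(For a noncommutative ring `A`, `Ideal A` is the type of left ideals.) -/
def IsMaximalClosedLeftIdeal {A : Type v} [Ring A] [TopologicalSpace A] (M : Ideal A) : Prop :=
  Maximal (fun N : Ideal A => IsClosed (N : Set A) ∧ N ≠ ⊤) M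

/-- The (topological) Jacobson radical of a pseudocompact algebra: the intersection of its maximal
closed left ideals. -/
def pseudocompactRadical (k : Type u) (A : Type v) [Field k] [Ring A] [Algebra k A]
    [TopologicalSpace A] [IsTopologicalRing A] [IsPseudocompactAlgebra k A] : Ideal A :=
  sInf {M : Ideal A | IsMaximalClosedLeftIdeal M}

theorem isClosed_of_isOpen_ideal {A : Type v} [Ring A] [TopologicalSpace A] [IsTopologicalRing A]
    {I : Ideal A} (h : IsOpen (I : Set A)) : IsClosed (I : Set A) :=
  AddSubgroup.isClosed_of_isOpen (Submodule.toAddSubgroup I) h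

theorem isOpen_of_le_ideal {A : Type v} [Ring A] [TopologicalSpace A] [IsTopologicalRing A]
    {I K : Ideal A} (hIK : I ≤ K) (h : IsOpen (I : Set A)) : IsOpen (K : Set A) :=
  AddSubgroup.isOpen_mono (H₁ := Submodule.toAddSubgroup I) (H₂ := Submodule.toAddSubgroup K)
    hIK h

theorem IsMaximalClosedLeftIdeal.isOpen (k : Type u) {A : Type v} [Field k] [Ring A] [Algebra k A]
    [TopologicalSpace A] [IsTopologicalRing A] [IsPseudocompactAlgebra k A] {M : Ideal A}
    (hM : IsMaximalClosedLeftIdeal M) : IsOpen (M : Set A) := by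
  obtain ⟨⟨hcl, hne⟩, hmax⟩ := hM
  have h1 : (1 : A) ∉ M := fun h => hne ((Ideal.eq_top_iff_one M).2 h)
  have hnhds : (fun x : A => 1 + x) ⁻¹' ((M : Set A)ᶜ) ∈ 𝓝 (0 : A) := by
    refine (hcl.isOpen_compl.preimage (continuous_const_add 1)).mem_nhds ?_
    simpa using h1
  obtain ⟨I, ⟨-, hI, -⟩, hsub⟩ :=
    (IsPseudocompactAlgebra.hasBasis_nhds_zero (k := k) (A := A)).mem_iff.1 hnhds
  have hopen : IsOpen ((M ⊔ I : Ideal A) : Set A) := isOpen_of_le_ideal le_sup_right hI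
  have hne' : M ⊔ I ≠ ⊤ := by
    intro h
    obtain ⟨m, hm, i, hi, hmi⟩ := Submodule.mem_sup.1 ((Ideal.eq_top_iff_one _).1 h)
    have : (1 : A) + -i ∉ M := hsub (I.neg_mem hi)
    apply this
    rw [← hmi]
    simpa using hm
  have hle := hmax ⟨isClosed_of_isOpen_ideal hopen, hne'⟩ le_sup_left
  exact isOpen_of_le_ideal (le_sup_right.trans hle) hI

/-- The Jacobson radical of a pseudocompact algebra is a two-sided ideal. -/
instance pseudocompactRadical.isTwoSided (k : Type u) (A : Type v) [Field k] [Ring A] [Algebra k A]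
    [TopologicalSpace A] [IsTopologicalRing A] [IsPseudocompactAlgebra k A] :
    (pseudocompactRadical k A).IsTwoSided where
  mul_mem_of_left := by
    intro x b hx
    refine Submodule.mem_sInf.2 fun (M : Ideal A) (hM : IsMaximalClosedLeftIdeal M) => ?_
    by_cases hb : b ∈ M
    · exact M.mul_mem_left x hb
    have hMo : IsOpen (M : Set A) := hM.isOpen k
    let N : Ideal A := Submodule.comap (LinearMap.toSpanSingleton A A b) M
    have hN : ∀ y, y ∈ N ↔ y * b ∈ M := fun y => Iff.rfl
    have hNo : IsOpen (N : Set A) := hMo.preimage (continuous_mul_const b)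
    have hNmax : IsMaximalClosedLeftIdeal N := by
      refine ⟨⟨isClosed_of_isOpen_ideal hNo, fun h => hb ?_⟩, ?_⟩
      · simpa [hN] using (Ideal.eq_top_iff_one N).1 h
      · rintro N' ⟨-, hN'⟩ hle y hy
        by_contra hyN
        have hlt : M ⊔ Ideal.span {y * b} = ⊤ := by
          by_contra hne
          have := hM.2 ⟨isClosed_of_isOpen_ideal (isOpen_of_le_ideal le_sup_left hMo), hne⟩
            le_sup_left
          exact hyN (this (Submodule.mem_sup_right (Ideal.subset_span rfl)))
        have hbmem : b ∈ M ⊔ Ideal.span {y * b} := hlt ▸ Submodule.mem_top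
        obtain ⟨m, hm, z, hz, hmz⟩ := Submodule.mem_sup.1 hbmem
        obtain ⟨c, rfl⟩ := Ideal.mem_span_singleton'.1 hz
        have h1 : 1 - c * y ∈ N := by
          rw [hN, sub_mul, one_mul, mul_assoc]
          have : b - c * (y * b) = m := by rw [sub_eq_iff_eq_add, hmz]
          rwa [this]
        apply hN'
        rw [Ideal.eq_top_iff_one]
        have := N'.add_mem (hle h1) (N'.mul_mem_left c hy)
        simpa using this
    exact Submodule.mem_sInf.1 hx N hNmax

/-- A topological ring is (left) *topologically semisimple* if every closed left ideal has a
closed left ideal as a complement. -/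
def IsTopologicallySemisimple (R : Type w) [Ring R] [TopologicalSpace R] : Prop :=
  ∀ I : Ideal R, IsClosed (I : Set R) → ∃ L : Ideal R, IsClosed (L : Set R) ∧ IsCompl I L

/-- The open two-sided ideals of a topological ring. -/
structure OpenTwoSidedIdeal (A : Type v) [Ring A] [TopologicalSpace A] where
  toIdeal : Ideal A
  isTwoSided : toIdeal.IsTwoSided
  isOpen : IsOpen (toIdeal : Set A)

attribute [instance] OpenTwoSidedIdeal.isTwoSided

section CompletedTensorProduct

variable (k : Type u) (A : Type v) (B : Type w) [Field k] [Ring A] [Algebra k A]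
  [TopologicalSpace A] [Ring B] [Algebra k B] [TopologicalSpace B]

/-- The algebra `A / I ⊗ B / K` for a pair `(I, K)` of open two-sided ideals of `A` and `B`. -/
abbrev QuotientTensor (p : OpenTwoSidedIdeal A × OpenTwoSidedIdeal B) : Type (max v w) :=
  (A ⧸ p.1.toIdeal) ⊗[k] (B ⧸ p.2.toIdeal)

/-- The projection `A / I ⊗ B / K → A / I' ⊗ B / K'` for `I ≤ I'` and `K ≤ K'`. -/
noncomputable def QuotientTensor.transition {p q : OpenTwoSidedIdeal A × OpenTwoSidedIdeal B}
    (h₁ : p.1.toIdeal ≤ q.1.toIdeal) (h₂ : p.2.toIdeal ≤ q.2.toIdeal) :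
    QuotientTensor k A B p →ₐ[k] QuotientTensor k A B q :=
  Algebra.TensorProduct.map (Ideal.Quotient.factorₐ k h₁) (Ideal.Quotient.factorₐ k h₂)

/-- The inverse limit of the algebras `A / I ⊗ B / K`, as the algebra of compatible families. -/
noncomputable def compatibleFamilies :
    Subalgebra k (∀ p : OpenTwoSidedIdeal A × OpenTwoSidedIdeal B, QuotientTensor k A B p) where
  carrier := {x | ∀ (p q : OpenTwoSidedIdeal A × OpenTwoSidedIdeal B)
    (h₁ : p.1.toIdeal ≤ q.1.toIdeal) (h₂ : p.2.toIdeal ≤ q.2.toIdeal),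
    QuotientTensor.transition k A B h₁ h₂ (x p) = x q}
  mul_mem' := by
    intro x y hx hy p q h₁ h₂
    rw [Pi.mul_apply, Pi.mul_apply, map_mul, hx p q h₁ h₂, hy p q h₁ h₂]
  add_mem' := by
    intro x y hx hy p q h₁ h₂
    rw [Pi.add_apply, Pi.add_apply, map_add, hx p q h₁ h₂, hy p q h₁ h₂]
  algebraMap_mem' := by
    intro c p q h₁ h₂
    rw [Pi.algebraMap_apply, Pi.algebraMap_apply, AlgHom.commutes]

/-- The completed tensor product of two pseudocompact algebras `A` and `B` over `k`: the inverse
limit of the finite-dimensional algebras `A / I ⊗ B / K`, where `I` and `K` run over the open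
two-sided ideals of `A` and `B`. -/
def CompletedTensorProduct : Type (max v w) := compatibleFamilies k A B

noncomputable instance CompletedTensorProduct.instRing : Ring (CompletedTensorProduct k A B) :=
  inferInstanceAs (Ring (compatibleFamilies k A B))

noncomputable instance CompletedTensorProduct.instAlgebra :
    Algebra k (CompletedTensorProduct k A B) :=
  inferInstanceAs (Algebra k (compatibleFamilies k A B))

/-- The inverse limit topology, each `A / I ⊗ B / K` being discrete. -/
instance CompletedTensorProduct.instTopologicalSpace :
    TopologicalSpace (CompletedTensorProduct k A B) :=
  ⨅ p : OpenTwoSidedIdeal A × OpenTwoSidedIdeal B,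
    TopologicalSpace.induced (fun x : compatibleFamilies k A B => x.1 p) ⊥

end CompletedTensorProduct

/-- A pseudocompact `k`-algebra `A` is *separable* if its completed scalar extension to every
finite field extension `E` of `k` (with the discrete topology) is topologically semisimple. -/
def IsSeparablePseudocompact (k : Type u) (A : Type v) [Field k] [Ring A] [Algebra k A]
    [TopologicalSpace A] : Prop :=
  ∀ (E : Type u) [Field E] [Algebra k E] [FiniteDimensional k E] [TopologicalSpace E]
    [DiscreteTopology E], IsTopologicallySemisimple (CompletedTensorProduct k A E)

/-!
Write `J` for the radical of `A`. The complement of `J` is found as a minimal closed subalgebra `S`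
with `S + J = A`.

Such an `S` exists by Zorn's lemma because `A` is linearly compact. This is obtained from duality:
by completeness `A` is the full algebraic dual of its space of continuous functionals
(`exists_forall_openDual_eq`), closed subspaces are annihilators of spaces of functionals, and for
algebraic duals the annihilator of `P ⊓ U` is the sum of the annihilators. Hence the condition
`S + J = A` passes to intersections of chains (`sInf_sup_eq_top_of_isChain`), sums of closed
subspaces are closed (`isClosed_sup`), and `(S ∩ I) + J` is open for every open ideal `I`
(`IsClosedSupplement.isOpen_inf_sup`).

To see that `S ∩ J = 0`, let `I` be an open two-sided ideal of finite codimension. The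
finite-dimensional algebra `C = S / (S ∩ I)` maps onto `D = A / ((S ∩ I) + J)` with kernel the image
of `S ∩ J`; this kernel is nilpotent, since it lies in the radical of `A / I`. The algebra `D` is a
quotient of `A / J` by an open ideal, so `D ⊗ E` is semisimple for each finite extension `E` of `k`,
as a quotient of the completed tensor product. If `C → D` splits, the preimage in `S` of the image
of the splitting is a closed subalgebra which still spans `A` together with `J`. By minimality it is
`S`, so `C → D` is injective and `S ∩ J ⊆ I` (`mem_of_minimal_isClosedSupplement`). Thus `S` maps
bijectively onto `A / J`, and the inverse is continuous because the images of the `S ∩ I` are open.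

The finite-dimensional splitting (`HasSeparabilityIdempotent.exists_algHom_section`) uses a
separability idempotent `∑ xⱼ ⊗ yⱼ` of `D`: a linear section that is multiplicative modulo a power
of the kernel is corrected by an explicit formula to one that is multiplicative modulo the next
power. The idempotent exists because `D` becomes a product of matrix algebras over the algebraic
closure of `k`, where it is written down with matrix units; as its defining equations are linear, it
descends to `k` (`HasSeparabilityIdempotent.of_baseChange`).
-/

/-! ### Separability idempotents and splittings -/

/-- The algebra `D` over `k` has a separability idempotent: an element `e = ∑ xⱼ ⊗ yⱼ` of `D ⊗ D`
with `∑ xⱼ yⱼ = 1` and `∑ d xⱼ ⊗ yⱼ = ∑ xⱼ ⊗ yⱼ d` for all `d`. -/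
def HasSeparabilityIdempotent (k : Type u) (D : Type v) [Field k] [Ring D] [Algebra k D] : Prop :=
  ∃ e : D ⊗[k] D, LinearMap.mul' k D e = 1 ∧
    ∀ d : D, (LinearMap.mulLeft k d).rTensor D e = (LinearMap.mulRight k d).lTensor D e

section Splitting

variable {k : Type u} {C : Type v} {D : Type w} [Field k] [Ring C] [Algebra k C] [Ring D]
  [Algebra k D]

/-- A separability idempotent as a finite family, balanced for every bilinear map. -/
theorem HasSeparabilityIdempotent.exists_finset (h : HasSeparabilityIdempotent k D) :
    ∃ t : Finset (D × D), ∑ j ∈ t, j.1 * j.2 = 1 ∧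
      ∀ (β : D →ₗ[k] D →ₗ[k] C) (d : D),
        ∑ j ∈ t, β (d * j.1) j.2 = ∑ j ∈ t, β j.1 (j.2 * d) := by
  obtain ⟨e, he1, he2⟩ := h
  obtain ⟨t, rfl⟩ := TensorProduct.exists_finset e
  refine ⟨t, by simpa using he1, fun β d => ?_⟩
  simpa using congrArg (TensorProduct.lift β) (he2 d)

/-- One Newton step: if `σ` is a linear section of `π` which is multiplicative modulo the `i`-th
power of the kernel, subtracting `a ↦ ∑ σ(xⱼ) (σ(yⱼ) σ(a) - σ(yⱼ a))` makes it multiplicative modulo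
the next power. -/
theorem exists_linear_section_mul_sub_mem_pow_succ (hD : HasSeparabilityIdempotent k D)
    (π : C →ₐ[k] D) (i : ℕ) (σ : D →ₗ[k] C) (hσ : ∀ d, π (σ d) = d)
    (hf : ∀ a b, σ a * σ b - σ (a * b) ∈ (RingHom.ker π) ^ i) :
    ∃ τ : D →ₗ[k] C, (∀ d, π (τ d) = d) ∧
      ∀ a b, τ a * τ b - τ (a * b) ∈ (RingHom.ker π) ^ (i + 1) := by
  obtain ⟨t, ht1, ht2⟩ := hD.exists_finset (C := C)
  have hf0 : ∀ a b, σ a * σ b - σ (a * b) ∈ RingHom.ker π := by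
    intro a b
    simp [RingHom.mem_ker, hσ]
  let h : D →ₗ[k] C := ∑ j ∈ t, LinearMap.mulLeft k (σ j.1) ∘ₗ
    (LinearMap.mulLeft k (σ j.2) ∘ₗ σ - σ ∘ₗ LinearMap.mulLeft k j.2)
  have h_apply : ∀ a, h a = ∑ j ∈ t, σ j.1 * (σ j.2 * σ a - σ (j.2 * a)) := by
    intro a
    simp [h]
  have h_mem : ∀ a, h a ∈ (RingHom.ker π) ^ i := fun a => by
    rw [h_apply]
    exact Submodule.sum_mem _ fun j _ => Ideal.mul_mem_left _ _ (hf _ _)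
  have h_mem0 : ∀ a, h a ∈ RingHom.ker π := fun a => by
    rw [h_apply]
    exact Submodule.sum_mem _ fun j _ => Ideal.mul_mem_left _ _ (hf0 _ _)
  refine ⟨σ - h, fun d => ?_, fun a b => ?_⟩
  · have := (RingHom.mem_ker).1 (h_mem0 d)
    simp [hσ, this]
  -- the balancing property, applied to `(x, y) ↦ σ(x) f(y, b)` with `f` the defect of `σ`
  have hbal := ht2 ((LinearMap.mul k C).compl₁₂ σ
    (LinearMap.mulRight k (σ b) ∘ₗ σ - σ ∘ₗ LinearMap.mulRight k b)) a
  simp only [LinearMap.compl₁₂_apply, LinearMap.mul_apply', LinearMap.sub_apply,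
    LinearMap.comp_apply, LinearMap.mulRight_apply] at hbal
  -- the cocycle identity of the defect, summed against `xⱼ ⊗ yⱼ`
  have hcocycle : (∑ j ∈ t, σ j.1 * σ j.2) * (σ a * σ b - σ (a * b)) + h (a * b) - h a * σ b =
      ∑ j ∈ t, σ j.1 * (σ (j.2 * a) * σ b - σ (j.2 * a * b)) := by
    rw [h_apply, h_apply, Finset.sum_mul, Finset.sum_mul, ← Finset.sum_add_distrib,
      ← Finset.sum_sub_distrib]
    refine Finset.sum_congr rfl fun j _ => ?_
    rw [mul_assoc j.2 a b]
    noncomm_ring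
  have hleft : ∑ j ∈ t, σ (a * j.1) * (σ j.2 * σ b - σ (j.2 * b)) = σ a * h b -
      ∑ j ∈ t, (σ a * σ j.1 - σ (a * j.1)) * (σ j.2 * σ b - σ (j.2 * b)) := by
    rw [h_apply, Finset.mul_sum, ← Finset.sum_sub_distrib]
    refine Finset.sum_congr rfl fun j _ => ?_
    noncomm_ring
  have key : (σ - h) a * (σ - h) b - (σ - h) (a * b) =
      (1 - ∑ j ∈ t, σ j.1 * σ j.2) * (σ a * σ b - σ (a * b)) -
      ∑ j ∈ t, (σ a * σ j.1 - σ (a * j.1)) * (σ j.2 * σ b - σ (j.2 * b)) + h a * h b := by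
    have e1 := hcocycle.trans (hbal.symm.trans hleft)
    have e2 : h (a * b) = h a * σ b + σ a * h b -
        ∑ j ∈ t, (σ a * σ j.1 - σ (a * j.1)) * (σ j.2 * σ b - σ (j.2 * b)) -
        (∑ j ∈ t, σ j.1 * σ j.2) * (σ a * σ b - σ (a * b)) := by
      rw [sub_eq_iff_eq_add, add_comm, ← eq_sub_iff_add_eq] at e1
      rw [e1]
      abel
    simp only [LinearMap.sub_apply]
    rw [e2]
    noncomm_ring
  rw [key, Ideal.IsTwoSided.pow_succ]
  refine add_mem (sub_mem (Ideal.mul_mem_mul ?_ (hf a b)) ?_)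
    (Ideal.mul_mem_mul (h_mem0 a) (h_mem b))
  · simp [RingHom.mem_ker, hσ, ht1]
  · exact Submodule.sum_mem _ fun j _ => Ideal.mul_mem_mul (hf0 _ _) (hf _ _)

/-- A surjection with nilpotent kernel onto an algebra with a separability idempotent splits. -/
theorem HasSeparabilityIdempotent.exists_algHom_section (hD : HasSeparabilityIdempotent k D)
    (π : C →ₐ[k] D) (hπ : Function.Surjective π) (hnil : IsNilpotent (RingHom.ker π)) :
    ∃ s : D →ₐ[k] C, ∀ d, π (s d) = d := by
  obtain ⟨m, hm⟩ := hnil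
  have hpow : ∀ i : ℕ, ∃ τ : D →ₗ[k] C, (∀ d, π (τ d) = d) ∧
      ∀ a b, τ a * τ b - τ (a * b) ∈ (RingHom.ker π) ^ i := by
    intro i
    induction i with
    | zero =>
      obtain ⟨σ, hσ⟩ := π.toLinearMap.exists_rightInverse_of_surjective
        (LinearMap.range_eq_top.2 hπ)
      exact ⟨σ, fun d => LinearMap.congr_fun hσ d, fun a b => by
        rw [Submodule.pow_zero, Ideal.one_eq_top]; trivial⟩
    | succ i ih =>
      obtain ⟨σ, hσ, hf⟩ := ih
      exact exists_linear_section_mul_sub_mem_pow_succ hD π i σ hσ hf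
  obtain ⟨τ, hτ, hmul⟩ := hpow m
  rw [hm] at hmul
  have hmul' : ∀ a b, τ (a * b) = τ a * τ b := fun a b =>
    (sub_eq_zero.1 ((Submodule.mem_bot C).1 (hmul a b))).symm
  -- `1 - τ 1` is an idempotent of the nilpotent kernel
  have hidem : ∀ n : ℕ, (1 - τ 1) ∈ (RingHom.ker π) ^ n := by
    intro n
    induction n with
    | zero => rw [Submodule.pow_zero, Ideal.one_eq_top]; trivial
    | succ n ih =>
      have h1 : (1 - τ 1) * (1 - τ 1) = 1 - τ 1 := by
        have := hmul' 1 1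
        rw [mul_one] at this
        rw [mul_sub, sub_mul, sub_mul, ← this]
        simp
      rw [← h1, Ideal.IsTwoSided.pow_succ]
      exact Ideal.mul_mem_mul (by simp [RingHom.mem_ker, hτ]) ih
  have hone : τ 1 = 1 := by
    have := hidem m
    rw [hm] at this
    exact (sub_eq_zero.1 ((Submodule.mem_bot C).1 this)).symm
  exact ⟨AlgHom.ofLinearMap τ hone hmul', hτ⟩

end Splitting

/-! ### Existence of separability idempotents -/

theorem HasSeparabilityIdempotent.of_algEquiv {k : Type u} {D : Type v} {D' : Type w} [Field k]
    [Ring D] [Algebra k D] [Ring D'] [Algebra k D'] (φ : D ≃ₐ[k] D')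
    (h : HasSeparabilityIdempotent k D) : HasSeparabilityIdempotent k D' := by
  obtain ⟨e, he1, he2⟩ := h
  have hmul : ∀ z : D ⊗[k] D,
      LinearMap.mul' k D' (TensorProduct.map φ.toLinearMap φ.toLinearMap z) =
      φ (LinearMap.mul' k D z) := by
    intro z
    induction z with
    | zero => simp
    | tmul x y => simp
    | add x y hx hy => simp only [map_add, hx, hy]
  have hl : ∀ (d : D) (z : D ⊗[k] D), (LinearMap.mulLeft k (φ d)).rTensor D'
      (TensorProduct.map φ.toLinearMap φ.toLinearMap z) =
      TensorProduct.map φ.toLinearMap φ.toLinearMap ((LinearMap.mulLeft k d).rTensor D z) := by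
    intro d z
    induction z with
    | zero => simp
    | tmul x y => simp
    | add x y hx hy => simp only [map_add, hx, hy]
  have hr : ∀ (d : D) (z : D ⊗[k] D), (LinearMap.mulRight k (φ d)).lTensor D'
      (TensorProduct.map φ.toLinearMap φ.toLinearMap z) =
      TensorProduct.map φ.toLinearMap φ.toLinearMap ((LinearMap.mulRight k d).lTensor D z) := by
    intro d z
    induction z with
    | zero => simp
    | tmul x y => simp
    | add x y hx hy => simp only [map_add, hx, hy]
  refine ⟨TensorProduct.map φ.toLinearMap φ.toLinearMap e, by rw [hmul, he1, map_one], fun d => ?_⟩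
  obtain ⟨d, rfl⟩ := φ.surjective d
  rw [hl, hr, he2]

/-- In a product of matrix algebras with matrix units `Eⁱ_{ab}`, the element
`∑ᵢ ∑ₐ Eⁱ_{ao} ⊗ Eⁱ_{oa}` is a separability idempotent, for any choice of indices `o`. -/
theorem hasSeparabilityIdempotent_pi_matrix (K : Type u) [Field K] {ι : Type v} [Fintype ι]
    [DecidableEq ι] (n : ι → Type w) [∀ i, Fintype (n i)] [∀ i, DecidableEq (n i)]
    [∀ i, Nonempty (n i)] :
    HasSeparabilityIdempotent K (∀ i, Matrix (n i) (n i) K) := by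
  let o : ∀ i, n i := fun i => Classical.arbitrary (n i)
  let E : ∀ i, n i → n i → ∀ i, Matrix (n i) (n i) K := fun i a b =>
    Pi.single i (Matrix.single a b 1)
  have hl : ∀ (d : ∀ i, Matrix (n i) (n i) K) (i : ι) (a c : n i),
      d * E i a c = ∑ b, d i b a • E i b c := by
    intro d i a c
    ext j x y
    rw [Finset.sum_apply, Matrix.sum_apply]
    by_cases hj : j = i
    · subst hj
      simp [E, Matrix.mul_apply, Matrix.single_apply, ite_and]
    · simp [E, hj]
  have hr : ∀ (d : ∀ i, Matrix (n i) (n i) K) (i : ι) (c a : n i),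
      E i c a * d = ∑ b, d i a b • E i c b := by
    intro d i c a
    ext j x y
    rw [Finset.sum_apply, Matrix.sum_apply]
    by_cases hj : j = i
    · subst hj
      simp [E, Matrix.mul_apply, Matrix.single_apply, ite_and]
    · simp [E, hj]
  refine ⟨∑ i, ∑ a, E i a (o i) ⊗ₜ[K] E i (o i) a, ?_, fun d => ?_⟩
  · simp only [map_sum, LinearMap.mul'_apply]
    have h1 : ∀ i (a : n i), E i a (o i) * E i (o i) a = Pi.single i (Matrix.single a a 1) := by
      intro i a
      simp only [E]
      rw [← Pi.single_mul, Matrix.single_mul_single_same, one_mul]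
    simp only [h1]
    ext j x y
    rw [Finset.sum_apply, Finset.sum_eq_single j]
    · simp [Matrix.sum_apply, Matrix.single_apply, Matrix.one_apply, ite_and]
    · intro i _ hij
      simp [hij.symm]
    · simp
  · simp only [map_sum, LinearMap.rTensor_tmul, LinearMap.lTensor_tmul, LinearMap.mulLeft_apply,
      LinearMap.mulRight_apply, hl, hr, TensorProduct.sum_tmul, TensorProduct.tmul_sum,
      TensorProduct.smul_tmul]
    exact Finset.sum_congr rfl fun i _ => Finset.sum_comm

/-- A separability idempotent descends along a field extension: its defining equations are linear,
so applying a `k`-linear retraction `K → k` to the coefficients gives a solution over `k`. -/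
theorem HasSeparabilityIdempotent.of_baseChange {k : Type u} {D : Type v} (K : Type w) [Field k]
    [Field K] [Algebra k K] [Ring D] [Algebra k D]
    (h : HasSeparabilityIdempotent K (K ⊗[k] D)) : HasSeparabilityIdempotent k D := by
  obtain ⟨e, he1, he2⟩ := h
  obtain ⟨ρ, hρ⟩ := (Algebra.linearMap k K).exists_leftInverse_of_injective
    (LinearMap.ker_eq_bot.2 (algebraMap k K).injective)
  have hρ1 : ρ 1 = 1 := by simpa using LinearMap.congr_fun hρ 1
  -- `(a ⊗ x) ⊗ (b ⊗ y) ↦ ρ(a b) x ⊗ y`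
  let Φ : (K ⊗[k] D) ⊗[K] (K ⊗[k] D) →ₗ[k] D ⊗[k] D :=
    TensorProduct.lid k (D ⊗[k] D) ∘ₗ ρ.rTensor (D ⊗[k] D) ∘ₗ
      (TensorProduct.AlgebraTensorModule.distribBaseChange
        k K D D).symm.toLinearMap.restrictScalars k
  have hΦ : ∀ (a b : K) (x y : D), Φ ((a ⊗ₜ[k] x) ⊗ₜ[K] (b ⊗ₜ[k] y)) = ρ (a * b) • x ⊗ₜ[k] y := by
    intro a b x y
    simp [Φ]
  have hind : ∀ {p : (K ⊗[k] D) ⊗[K] (K ⊗[k] D) → Prop},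
      (∀ a b x y, p ((a ⊗ₜ[k] x) ⊗ₜ[K] (b ⊗ₜ[k] y))) → p 0 → (∀ z z', p z → p z' → p (z + z')) →
      ∀ z, p z := by
    intro p h1 h0 h2 z
    induction z with
    | zero => exact h0
    | add z z' hz hz' => exact h2 z z' hz hz'
    | tmul z z' =>
      induction z with
      | zero => simpa using h0
      | add z1 z2 h1 h2' => rw [TensorProduct.add_tmul]; exact h2 _ _ h1 h2'
      | tmul a x =>
        induction z' with
        | zero => simpa using h0
        | add z1 z2 h1 h2' => rw [TensorProduct.tmul_add]; exact h2 _ _ h1 h2'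
        | tmul b y => exact h1 a b x y
  have hmul : ∀ z, LinearMap.mul' k D (Φ z) =
      TensorProduct.lid k D (ρ.rTensor D (LinearMap.mul' K (K ⊗[k] D) z)) := by
    refine hind ?_ ?_ ?_
    · intro a b x y
      simp [hΦ]
    · simp
    · intro z z' hz hz'
      simp only [map_add, hz, hz']
  have hl : ∀ d z, (LinearMap.mulLeft k d).rTensor D (Φ z) =
      Φ ((LinearMap.mulLeft K ((1 : K) ⊗ₜ[k] d)).rTensor (K ⊗[k] D) z) := by
    intro d
    refine hind ?_ ?_ ?_
    · intro a b x y
      simp [hΦ]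
    · simp
    · intro z z' hz hz'
      simp only [map_add, hz, hz']
  have hr : ∀ d z, (LinearMap.mulRight k d).lTensor D (Φ z) =
      Φ ((LinearMap.mulRight K ((1 : K) ⊗ₜ[k] d)).lTensor (K ⊗[k] D) z) := by
    intro d
    refine hind ?_ ?_ ?_
    · intro a b x y
      simp [hΦ]
    · simp
    · intro z z' hz hz'
      simp only [map_add, hz, hz']
  refine ⟨Φ e, ?_, fun d => by rw [hl, hr, he2]⟩
  rw [hmul, he1, Algebra.TensorProduct.one_def]
  simp [hρ1]

theorem Ideal.comap_pow_le {R : Type u} {S : Type v} [Ring R] [Ring S] (f : R →+* S) (I : Ideal S)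
    [I.IsTwoSided] (n : ℕ) : (I.comap f) ^ n ≤ (I ^ n).comap f := by
  induction n with
  | zero =>
    intro x _
    rw [Ideal.mem_comap, Submodule.pow_zero, Ideal.one_eq_top]
    trivial
  | succ n ih =>
    rw [Ideal.IsTwoSided.pow_succ, Ideal.IsTwoSided.pow_succ, Ideal.mul_le]
    intro a ha b hb
    rw [Ideal.mem_comap, map_mul]
    exact Ideal.mul_mem_mul ha (ih hb)

theorem isNilpotent_comap_of_injective {R : Type u} {S : Type v} [Ring R] [Ring S] {f : R →+* S}
    (hf : Function.Injective f) {I : Ideal S} [I.IsTwoSided] (hI : IsNilpotent I) :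
    IsNilpotent (I.comap f) := by
  obtain ⟨n, hn⟩ := hI
  refine ⟨n, le_bot_iff.1 fun x hx => ?_⟩
  have := Ideal.comap_pow_le f I n hx
  rw [hn, Ideal.mem_comap] at this
  exact hf (((Submodule.mem_bot S).1 this).trans (map_zero f).symm)

theorem IsSemisimpleRing.eq_bot_of_isNilpotent {R : Type u} [Ring R] [IsSemisimpleRing R]
    {I : Ideal R} [I.IsTwoSided] (hI : IsNilpotent I) : I = ⊥ := by
  obtain ⟨n, hn⟩ := hI
  obtain ⟨L, hL⟩ := exists_isCompl I
  -- writing `1 = a + l`, every `x ∈ I` satisfies `x = x a`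
  obtain ⟨a, ha, l, hl, hal⟩ := Submodule.mem_sup.1
    (show (1 : R) ∈ I ⊔ L from hL.sup_eq_top ▸ Submodule.mem_top)
  have hx : ∀ x ∈ I, x = x * a := by
    intro x hx
    have h1 : x * l ∈ I ⊓ L := ⟨I.mul_mem_right l hx, L.mul_mem_left x hl⟩
    rw [hL.inf_eq_bot, Submodule.mem_bot] at h1
    calc x = x * (a + l) := by rw [hal, mul_one]
      _ = x * a := by rw [mul_add, h1, add_zero]
  refine le_bot_iff.1 fun x hxI => ?_
  have hpow : ∀ m : ℕ, ∀ x ∈ I, x ∈ I ^ m := by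
    intro m
    induction m with
    | zero => intro x _; rw [Submodule.pow_zero, Ideal.one_eq_top]; trivial
    | succ m ih =>
      intro x hxI
      rw [hx x hxI, Ideal.IsTwoSided.pow_succ]
      exact Ideal.mul_mem_mul hxI (ih a ha)
  have := hpow n x hxI
  rwa [hn] at this

theorem exists_finiteDimensional_mem_range_map {k : Type u} {D : Type v} {K : Type w} [Field k]
    [Field K] [Algebra k K] [Algebra.IsAlgebraic k K] [Ring D] [Algebra k D] (x : K ⊗[k] D) :
    ∃ (E : IntermediateField k K) (_ : FiniteDimensional k E),
      x ∈ (Algebra.TensorProduct.map E.val (AlgHom.id k D)).range := by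
  induction x with
  | zero => exact ⟨⊥, inferInstance, zero_mem _⟩
  | tmul a d =>
    refine ⟨IntermediateField.adjoin k {a}, IntermediateField.adjoin.finiteDimensional
      (Algebra.IsIntegral.isIntegral a), ?_⟩
    exact ⟨(⟨a, IntermediateField.mem_adjoin_simple_self k a⟩ :
      IntermediateField.adjoin k {a}) ⊗ₜ d, by simp⟩
  | add x y hx hy =>
    obtain ⟨E, hE, x, rfl⟩ := hx
    obtain ⟨F, hF, y, rfl⟩ := hy
    refine ⟨E ⊔ F, inferInstance, add_mem ?_ ?_⟩
    · refine ⟨Algebra.TensorProduct.map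
        (IntermediateField.inclusion (le_sup_left : E ≤ E ⊔ F)) (AlgHom.id k D) x, ?_⟩
      change ((Algebra.TensorProduct.map (E ⊔ F).val (AlgHom.id k D)).comp
        (Algebra.TensorProduct.map _ (AlgHom.id k D))) x = _
      rw [← Algebra.TensorProduct.map_comp]
      rfl
    · refine ⟨Algebra.TensorProduct.map
        (IntermediateField.inclusion (le_sup_right : F ≤ E ⊔ F)) (AlgHom.id k D) y, ?_⟩
      change ((Algebra.TensorProduct.map (E ⊔ F).val (AlgHom.id k D)).comp
        (Algebra.TensorProduct.map _ (AlgHom.id k D))) y = _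
      rw [← Algebra.TensorProduct.map_comp]
      rfl

/-- If `E ⊗ D` is semisimple for all finite extensions `E` inside an algebraic extension `K` of `k`,
then so is `K ⊗ D`: an element of the radical already lives over a finite extension, where it
lies in a nilpotent ideal. -/
theorem isSemisimpleRing_tensor_of_finite {k : Type u} {D : Type v} (K : Type w) [Field k]
    [Field K] [Algebra k K] [Algebra.IsAlgebraic k K] [Ring D] [Algebra k D]
    [FiniteDimensional k D]
    (h : ∀ E : IntermediateField k K, FiniteDimensional k E → IsSemisimpleRing (E ⊗[k] D)) :
    IsSemisimpleRing (K ⊗[k] D) := by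
  have : IsArtinianRing (K ⊗[k] D) := IsArtinianRing.of_finite K (K ⊗[k] D)
  rw [IsArtinianRing.isSemisimpleRing_iff_jacobson]
  refine le_bot_iff.1 fun x hx => ?_
  obtain ⟨E, hE, x, rfl⟩ := exists_finiteDimensional_mem_range_map x
  have := h E hE
  have hinj : Function.Injective (Algebra.TensorProduct.map E.val (AlgHom.id k D)) :=
    Module.Flat.rTensor_preserves_injective_linearMap (M := D) E.val.toLinearMap E.val.injective
  have hnil := isNilpotent_comap_of_injective
    (f := (Algebra.TensorProduct.map E.val (AlgHom.id k D)).toRingHom) hinj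
    (IsSemiprimaryRing.isNilpotent (R := K ⊗[k] D))
  have h0 : x ∈ (⊥ : Ideal (E ⊗[k] D)) := IsSemisimpleRing.eq_bot_of_isNilpotent hnil ▸ hx
  rw [(Submodule.mem_bot _).1 h0]
  exact zero_mem _

/-- A finite-dimensional algebra that stays semisimple over every finite extension of `k` has a
separability idempotent: over the algebraic closure it becomes a product of matrix algebras. -/
theorem hasSeparabilityIdempotent_of_isSemisimpleRing {k : Type u} {D : Type v} [Field k] [Ring D]
    [Algebra k D] [FiniteDimensional k D]
    (h : ∀ (E : Type u) [Field E] [Algebra k E] [FiniteDimensional k E],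
      IsSemisimpleRing (D ⊗[k] E)) : HasSeparabilityIdempotent k D := by
  have hss : IsSemisimpleRing (AlgebraicClosure k ⊗[k] D) :=
    isSemisimpleRing_tensor_of_finite _ fun E _ =>
      have := h E
      (Algebra.TensorProduct.comm k D E).toRingEquiv.isSemisimpleRing
  obtain ⟨n, d, hd, ⟨φ⟩⟩ := IsSemisimpleRing.exists_algEquiv_pi_matrix_of_isAlgClosed
    (AlgebraicClosure k) (AlgebraicClosure k ⊗[k] D)
  exact ((hasSeparabilityIdempotent_pi_matrix (AlgebraicClosure k)
    fun i => Fin (d i)).of_algEquiv φ.symm).of_baseChange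

/-! ### Open quotients of separable algebras -/

theorem IsTopologicallySemisimple.isSemisimpleRing_of_surjective {R : Type v} {S : Type w} [Ring R]
    [TopologicalSpace R] [Ring S] (h : IsTopologicallySemisimple R) (f : R →+* S)
    (hf : Function.Surjective f) (hcl : ∀ t : Set S, IsClosed (f ⁻¹' t)) : IsSemisimpleRing S := by
  rw [IsSemisimpleRing, isSemisimpleModule_iff]
  refine ⟨fun (I : Ideal S) => ?_⟩
  obtain ⟨L, -, hL⟩ := h (Ideal.comap f I) (hcl I)
  refine ⟨Ideal.map f L, ?_⟩
  rw [isCompl_iff, disjoint_iff, codisjoint_iff]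
  constructor
  · refine le_bot_iff.1 fun x hx => ?_
    obtain ⟨l, hl, rfl⟩ := (Ideal.mem_map_iff_of_surjective f hf).1 hx.2
    have h0 : l ∈ Ideal.comap f I ⊓ L := ⟨hx.1, hl⟩
    rw [hL.inf_eq_bot] at h0
    rw [(Submodule.mem_bot _).1 h0, map_zero]
    exact zero_mem _
  · rw [Ideal.eq_top_iff_one, Submodule.mem_sup]
    obtain ⟨i, hi, l, hl, hil⟩ := Submodule.mem_sup.1
      (show (1 : R) ∈ Ideal.comap f I ⊔ L from hL.sup_eq_top ▸ Submodule.mem_top)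
    exact ⟨f i, hi, f l, Ideal.mem_map_of_mem f hl, by rw [← map_add, hil, map_one]⟩

section

variable (k : Type u) (A : Type v) (B : Type w) [Field k] [Ring A] [Algebra k A]
  [TopologicalSpace A] [Ring B] [Algebra k B] [TopologicalSpace B]

/-- The projection of the completed tensor product to one of its finite stages. -/
noncomputable def CompletedTensorProduct.proj (p : OpenTwoSidedIdeal A × OpenTwoSidedIdeal B) :
    CompletedTensorProduct k A B →+* QuotientTensor k A B p :=
  (Pi.evalRingHom (fun p => QuotientTensor k A B p) p).comp
    (compatibleFamilies k A B).val.toRingHom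

theorem CompletedTensorProduct.isClosed_preimage_proj
    (p : OpenTwoSidedIdeal A × OpenTwoSidedIdeal B) (t : Set (QuotientTensor k A B p)) :
    IsClosed (CompletedTensorProduct.proj k A B p ⁻¹' t) := by
  let _ : TopologicalSpace (QuotientTensor k A B p) := ⊥
  have : DiscreteTopology (QuotientTensor k A B p) := ⟨rfl⟩
  exact (isClosed_discrete t).preimage (continuous_iInf_dom (i := p) continuous_induced_dom)

theorem CompletedTensorProduct.proj_surjective (p : OpenTwoSidedIdeal A × OpenTwoSidedIdeal B) :
    Function.Surjective (CompletedTensorProduct.proj k A B p) := by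
  -- the image contains the image of the uncompleted tensor product
  let g : ∀ q : OpenTwoSidedIdeal A × OpenTwoSidedIdeal B, A ⊗[k] B →ₐ[k] QuotientTensor k A B q :=
    fun q => Algebra.TensorProduct.map (Ideal.Quotient.mkₐ k q.1.toIdeal)
      (Ideal.Quotient.mkₐ k q.2.toIdeal)
  have hg : ∀ z, (fun q => g q z) ∈ compatibleFamilies k A B := by
    intro z q r h₁ h₂
    change ((QuotientTensor.transition k A B h₁ h₂).comp (g q)) z = g r z
    congr 1
    rw [QuotientTensor.transition, ← Algebra.TensorProduct.map_comp]
    rfl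
  intro y
  obtain ⟨z, rfl⟩ : ∃ z, g p z = y :=
    TensorProduct.map_surjective (Ideal.Quotient.mkₐ_surjective k p.1.toIdeal)
      (Ideal.Quotient.mkₐ_surjective k p.2.toIdeal) y
  exact ⟨⟨fun q => g q z, hg z⟩, rfl⟩

end

theorem IsSeparablePseudocompact.hasSeparabilityIdempotent {k : Type u} {B : Type v} [Field k]
    [Ring B] [Algebra k B] [TopologicalSpace B] (h : IsSeparablePseudocompact k B)
    (K : OpenTwoSidedIdeal B) [FiniteDimensional k (B ⧸ K.toIdeal)] :
    HasSeparabilityIdempotent k (B ⧸ K.toIdeal) := by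
  refine hasSeparabilityIdempotent_of_isSemisimpleRing fun E _ _ _ => ?_
  let _ : TopologicalSpace E := ⊥
  have : DiscreteTopology E := ⟨rfl⟩
  let p : OpenTwoSidedIdeal B × OpenTwoSidedIdeal E := (K, ⟨⊥, inferInstance, isOpen_discrete _⟩)
  have : IsSemisimpleRing (QuotientTensor k B E p) :=
    (h E).isSemisimpleRing_of_surjective (CompletedTensorProduct.proj k B E p)
      (CompletedTensorProduct.proj_surjective k B E p)
      (CompletedTensorProduct.isClosed_preimage_proj k B E p)
  exact (Algebra.TensorProduct.congr (AlgEquiv.refl (R := k) (A₁ := B ⧸ K.toIdeal))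
    (AlgEquiv.quotientBot k E)).toRingEquiv.isSemisimpleRing

/-! ### Duality for pseudocompact algebras -/

section Duality

theorem Submodule.isOpen_mono_of_le {k : Type u} {A : Type v} [Field k] [Ring A] [Algebra k A]
    [TopologicalSpace A] [IsTopologicalRing A] {V W : Submodule k A} (h : V ≤ W)
    (hV : IsOpen (V : Set A)) : IsOpen (W : Set A) :=
  AddSubgroup.isOpen_mono (H₁ := V.toAddSubgroup) (H₂ := W.toAddSubgroup) h hV

theorem Submodule.isClosed_of_isOpen {k : Type u} {A : Type v} [Field k] [Ring A] [Algebra k A]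
    [TopologicalSpace A] [IsTopologicalRing A] {V : Submodule k A}
    (hV : IsOpen (V : Set A)) : IsClosed (V : Set A) :=
  AddSubgroup.isClosed_of_isOpen V.toAddSubgroup hV

variable (k : Type u) (A : Type v) [Field k] [Ring A] [Algebra k A] [TopologicalSpace A]
  [IsTopologicalRing A]

/-- The continuous dual of `A`, where `k` is discrete: the linear functionals with open kernel. -/
def openDual : Submodule k (Module.Dual k A) where
  carrier := {f | IsOpen (LinearMap.ker f : Set A)}
  add_mem' := by
    intro f g hf hg
    refine Submodule.isOpen_mono_of_le (V := LinearMap.ker f ⊓ LinearMap.ker g) ?_ (hf.inter hg)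
    rintro x ⟨hx, hy⟩
    simp [LinearMap.mem_ker.1 hx, LinearMap.mem_ker.1 hy]
  zero_mem' := by simp
  smul_mem' := by
    intro c f hf
    refine Submodule.isOpen_mono_of_le (V := LinearMap.ker f) (fun x hx => ?_) hf
    simp [LinearMap.mem_ker.1 hx]

variable {k A}

theorem exists_openDual_ne_zero_of_isOpen {W : Submodule k A} (hW : IsOpen (W : Set A)) {a : A}
    (ha : a ∉ W) : ∃ f : openDual k A, W ≤ LinearMap.ker f.1 ∧ f.1 a ≠ 0 := by
  obtain ⟨f, hf, hfW⟩ := Submodule.exists_le_ker_of_notMem ha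
  exact ⟨⟨f, Submodule.isOpen_mono_of_le hfW hW⟩, hfW, hf⟩

/-- The annihilator of a subspace of `A` in the continuous dual. -/
def openAnnihilator (W : Submodule k A) : Submodule k (openDual k A) :=
  W.dualAnnihilator.comap (openDual k A).subtype

theorem mem_openAnnihilator {W : Submodule k A} {f : openDual k A} :
    f ∈ openAnnihilator W ↔ ∀ w ∈ W, f.1 w = 0 :=
  Submodule.mem_dualAnnihilator f.1

/-- A linear form on the continuous dual is evaluation at a point, as far as the functionals
vanishing on a fixed open subspace of finite codimension are concerned. -/
theorem exists_eq_eval_of_le_ker (φ : Module.Dual k (openDual k A)) (W : Submodule k A)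
    (hW : IsOpen (W : Set A)) [FiniteDimensional k (A ⧸ W)] :
    ∃ c : A, ∀ f : openDual k A, W ≤ LinearMap.ker f.1 → φ f = f.1 c := by
  let r : Module.Dual k (A ⧸ W) →ₗ[k] openDual k A :=
    (W.mkQ.dualMap).codRestrict (openDual k A) fun g =>
      Submodule.isOpen_mono_of_le (V := W)
        (fun x hx => by simp [(Submodule.Quotient.mk_eq_zero W).2 hx]) hW
  obtain ⟨c, hc⟩ := (Module.evalEquiv k (A ⧸ W)).surjective (φ ∘ₗ r)
  obtain ⟨c, rfl⟩ := W.mkQ_surjective c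
  refine ⟨c, fun f hf => ?_⟩
  have h1 : r (W.liftQ f.1 hf) = f := by
    ext x
    rfl
  have h2 := LinearMap.congr_fun hc (W.liftQ f.1 hf)
  simp only [LinearMap.comp_apply, h1] at h2
  rw [← h2]
  simp

/-- A subspace which contains every point killed by its annihilator is closed. -/
theorem isClosed_of_forall_openAnnihilator {W : Submodule k A}
    (h : ∀ a, (∀ f ∈ openAnnihilator W, f.1 a = 0) → a ∈ W) : IsClosed (W : Set A) := by
  have : (W : Set A) = ⋂ f ∈ openAnnihilator W, (LinearMap.ker f.1 : Set A) := by
    ext a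
    simp only [Set.mem_iInter, SetLike.mem_coe, LinearMap.mem_ker]
    exact ⟨fun ha f hf => mem_openAnnihilator.1 hf a ha, h a⟩
  rw [this]
  exact isClosed_biInter fun f _ => Submodule.isClosed_of_isOpen f.2

variable [IsPseudocompactAlgebra k A]

/-- The continuous functionals separate points from closed subspaces. -/
theorem exists_openDual_ne_zero {W : Submodule k A} (hW : IsClosed (W : Set A)) {a : A}
    (ha : a ∉ W) : ∃ f : openDual k A, W ≤ LinearMap.ker f.1 ∧ f.1 a ≠ 0 := by
  have hnhds : (fun x : A => a + x) ⁻¹' ((W : Set A)ᶜ) ∈ 𝓝 (0 : A) := by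
    refine (hW.isOpen_compl.preimage (continuous_const_add a)).mem_nhds ?_
    simpa using ha
  obtain ⟨I, ⟨-, hI, -⟩, hsub⟩ :=
    (IsPseudocompactAlgebra.hasBasis_nhds_zero (k := k) (A := A)).mem_iff.1 hnhds
  have hopen : IsOpen ((W ⊔ I.restrictScalars k : Submodule k A) : Set A) :=
    Submodule.isOpen_mono_of_le (V := I.restrictScalars k) le_sup_right hI
  have hmem : a ∉ W ⊔ I.restrictScalars k := by
    intro h
    obtain ⟨w, hw, i, hi, hwi⟩ := Submodule.mem_sup.1 h
    have h1 : a + -i ∉ W := hsub (I.neg_mem hi)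
    apply h1
    rw [← hwi]
    simpa using hw
  obtain ⟨f, hf, hfa⟩ := exists_openDual_ne_zero_of_isOpen hopen hmem
  exact ⟨f, le_sup_left.trans hf, hfa⟩

theorem eq_zero_of_forall_openDual {a : A} (h : ∀ f : openDual k A, f.1 a = 0) : a = 0 := by
  refine IsPseudocompactAlgebra.eq_zero_of_forall_mem (k := k) a fun I _ hI _ => ?_
  by_contra ha
  obtain ⟨f, -, hf⟩ := exists_openDual_ne_zero_of_isOpen (W := I.restrictScalars k) hI ha
  exact hf (h f)

/-- Completeness: every linear form on the continuous dual is the evaluation at a point. -/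
theorem exists_forall_openDual_eq (φ : Module.Dual k (openDual k A)) :
    ∃ a : A, ∀ f : openDual k A, φ f = f.1 a := by
  have hbasis := IsPseudocompactAlgebra.hasBasis_nhds_zero (k := k) (A := A)
  let ι := {I : Ideal A // I.IsTwoSided ∧ IsOpen (I : Set A) ∧ FiniteDimensional k (A ⧸ I)}
  have hstage : ∀ i : ι, ∃ c : A, ∀ f : openDual k A,
      i.1.restrictScalars k ≤ LinearMap.ker f.1 → φ f = f.1 c := by
    rintro ⟨I, hI1, hI2, hI3⟩
    have : FiniteDimensional k (A ⧸ I.restrictScalars k) :=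
      (Submodule.Quotient.restrictScalarsEquiv k I).symm.finiteDimensional
    exact exists_eq_eval_of_le_ker φ (I.restrictScalars k) hI2
  choose c hc using hstage
  have hcompat : ∀ i j : ι, i.1 ≤ j.1 → c i - c j ∈ j.1 := by
    intro i j hij
    by_contra hn
    obtain ⟨f, hf, hne⟩ := exists_openDual_ne_zero_of_isOpen (W := j.1.restrictScalars k)
      j.2.2.1 hn
    apply hne
    rw [map_sub, ← hc i f (le_trans (fun x hx => hij hx) hf), ← hc j f hf, sub_self]
  have hι : Nonempty ι := by
    obtain ⟨I, hI, -⟩ := hbasis.mem_iff.1 Filter.univ_mem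
    exact ⟨⟨I, hI⟩⟩
  -- the cosets `c i + i` generate a Cauchy filter, whose limit represents `φ`
  let s : ι → Set A := fun i => {x | x - c i ∈ i.1}
  have hdir : Directed (· ⊇ ·) s := by
    intro i j
    obtain ⟨I, hI, hsub⟩ := hbasis.mem_iff.1
      (Filter.inter_mem (i.2.2.1.mem_nhds (zero_mem i.1)) (j.2.2.1.mem_nhds (zero_mem j.1)))
    refine ⟨⟨I, hI⟩, fun x hx => ?_, fun x hx => ?_⟩
    · have := i.1.add_mem (hsub hx).1
        (hcompat ⟨I, hI⟩ i fun y hy => (hsub hy).1)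
      simpa [s] using this
    · have := j.1.add_mem (hsub hx).2
        (hcompat ⟨I, hI⟩ j fun y hy => (hsub hy).2)
      simpa [s] using this
  have hF := Filter.hasBasis_iInf_principal hdir
  have hne : (⨅ i, Filter.principal (s i)).NeBot :=
    hF.neBot_iff.2 fun {i} _ => ⟨c i, by simp [s]⟩
  obtain ⟨a, ha⟩ : ∃ a : A, (⨅ i, Filter.principal (s i)) ≤ 𝓝 a := by
    let _ : UniformSpace A := IsTopologicalAddGroup.rightUniformSpace A
    have : CompleteSpace A := IsPseudocompactAlgebra.completeSpace k
    refine CompleteSpace.complete ⟨hne, ?_⟩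
    rw [uniformity_eq_comap_nhds_zero' A, (hF.prod_self).le_basis_iff (hbasis.comap _)]
    intro I hI
    refine ⟨⟨I, hI⟩, trivial, ?_⟩
    rintro ⟨x, y⟩ ⟨hx, hy⟩
    have := I.sub_mem hy hx
    simpa [sub_eq_add_neg] using this
  refine ⟨a, fun f => ?_⟩
  obtain ⟨I, hI, hsub⟩ := hbasis.mem_iff.1 (f.2.mem_nhds (zero_mem (LinearMap.ker f.1)))
  have h1 : {y : A | y - a ∈ I} ∈ 𝓝 a :=
    (hI.2.1.preimage (continuous_sub_right a)).mem_nhds (by simp)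
  obtain ⟨y, hy1, hy2⟩ := hne.nonempty_of_mem
    (Filter.inter_mem (ha h1) (hF.mem_of_mem (i := ⟨I, hI⟩) trivial))
  rw [hc ⟨I, hI⟩ f fun x hx => hsub hx]
  have h2 : f.1 (y - a) = 0 := hsub hy1
  have h3 : f.1 (y - c ⟨I, hI⟩) = 0 := hsub hy2
  rw [map_sub, sub_eq_zero] at h2 h3
  rw [← h2, ← h3]

/-- Duality turns intersections of spaces of functionals into sums of annihilators: a point killed
by `P ⊓ U` is a sum of a point killed by `P` and a point killed by `U`. -/
theorem exists_add_of_forall_mem_inf (P U : Submodule k (openDual k A)) {a : A}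
    (h : ∀ f ∈ P ⊓ U, f.1 a = 0) :
    ∃ b c : A, b + c = a ∧ (∀ f ∈ P, f.1 b = 0) ∧ ∀ f ∈ U, f.1 c = 0 := by
  let φ : Module.Dual k (openDual k A) :=
    (LinearMap.applyₗ a : Module.Dual k A →ₗ[k] k) ∘ₗ (openDual k A).subtype
  have hφ : φ ∈ (P ⊓ U).dualAnnihilator := (Submodule.mem_dualAnnihilator φ).2 h
  obtain ⟨ψ, hψ, χ, hχ, hsum⟩ := Submodule.mem_sup.1
    ((Subspace.dualAnnihilator_inf_eq (K := k) (V₁ := openDual k A) P U).le hφ)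
  obtain ⟨b, hb⟩ := exists_forall_openDual_eq ψ
  obtain ⟨c, hc⟩ := exists_forall_openDual_eq χ
  refine ⟨b, c, ?_, fun f hf => ?_, fun f hf => ?_⟩
  · rw [← sub_eq_zero]
    refine eq_zero_of_forall_openDual (k := k) fun f => ?_
    rw [map_sub, map_add, ← hb, ← hc, ← LinearMap.add_apply, hsum, sub_eq_zero]
    rfl
  · rw [← hb]
    exact (Submodule.mem_dualAnnihilator ψ).1 hψ f hf
  · rw [← hc]
    exact (Submodule.mem_dualAnnihilator χ).1 hχ f hf

theorem mem_of_forall_mem_openAnnihilator {W : Submodule k A} (hW : IsClosed (W : Set A)) {a : A}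
    (h : ∀ f ∈ openAnnihilator W, f.1 a = 0) : a ∈ W := by
  by_contra ha
  obtain ⟨f, hf, hne⟩ := exists_openDual_ne_zero hW ha
  exact hne (h f (mem_openAnnihilator.2 fun w hw => hf hw))

/-- The sum of two closed subspaces of a pseudocompact algebra is closed. -/
theorem isClosed_sup {V W : Submodule k A} (hV : IsClosed (V : Set A)) (hW : IsClosed (W : Set A)) :
    IsClosed ((V ⊔ W : Submodule k A) : Set A) := by
  refine isClosed_of_forall_openAnnihilator fun a ha => ?_
  obtain ⟨b, c, rfl, hb, hc⟩ := exists_add_of_forall_mem_inf (openAnnihilator V)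
    (openAnnihilator W) (a := a) fun f hf => ha f <| mem_openAnnihilator.2 fun x hx => by
      obtain ⟨y, hy, z, hz, rfl⟩ := Submodule.mem_sup.1 hx
      rw [map_add, mem_openAnnihilator.1 hf.1 y hy, mem_openAnnihilator.1 hf.2 z hz, add_zero]
  exact Submodule.add_mem_sup (mem_of_forall_mem_openAnnihilator hV hb)
    (mem_of_forall_mem_openAnnihilator hW hc)

/-- A closed subspace of finite codimension is open: it is cut out by finitely many continuous
functionals. -/
theorem isOpen_of_isClosed_of_finiteDimensional {W : Submodule k A} (hW : IsClosed (W : Set A))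
    [FiniteDimensional k (A ⧸ W)] : IsOpen (W : Set A) := by
  have h1 : FiniteDimensional k W.dualAnnihilator :=
    W.dualQuotEquivDualAnnihilator.finiteDimensional
  have h2 : FiniteDimensional k
      (openDual k A ⊓ W.dualAnnihilator : Submodule k (Module.Dual k A)) :=
    Submodule.finiteDimensional_of_le inf_le_right
  obtain ⟨t, ht⟩ := Module.Finite.iff_fg.1 h2
  have hmem : ∀ f ∈ t, f ∈ openDual k A ⊓ W.dualAnnihilator := fun f hf =>
    ht ▸ Submodule.subset_span hf
  have : (W : Set A) = ⋂ f ∈ t, (LinearMap.ker f : Set A) := by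
    ext a
    simp only [Set.mem_iInter, SetLike.mem_coe, LinearMap.mem_ker]
    refine ⟨fun ha f hf => (Submodule.mem_dualAnnihilator f).1 (hmem f hf).2 a ha, fun ha => ?_⟩
    refine mem_of_forall_mem_openAnnihilator hW fun f hf => ?_
    have hft : f.1 ∈ Submodule.span k (t : Set (Module.Dual k A)) := ht ▸ ⟨f.2, hf⟩
    have hle : Submodule.span k (t : Set (Module.Dual k A)) ≤
        LinearMap.ker (LinearMap.applyₗ a : Module.Dual k A →ₗ[k] k) := Submodule.span_le.2 ha
    exact hle hft
  rw [this]
  exact isOpen_biInter_finset fun f hf => (hmem f hf).1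

/-- Linear compactness: if every member of a chain of closed subspaces spans `A` together with a
closed subspace `J`, then so does the intersection of the chain. -/
theorem sInf_sup_eq_top_of_isChain {c : Set (Submodule k A)} (hc : IsChain (· ≤ ·) c)
    (hne : c.Nonempty) (hcl : ∀ W ∈ c, IsClosed (W : Set A)) {J : Submodule k A}
    (hJ : IsClosed (J : Set A)) (h : ∀ W ∈ c, W ⊔ J = ⊤) : sInf c ⊔ J = ⊤ := by
  -- a functional in the supremum of the annihilators lies in one of them, by directedness
  have hdir : DirectedOn (· ≤ ·) (openAnnihilator '' c) := by
    rintro _ ⟨V, hV, rfl⟩ _ ⟨W, hW, rfl⟩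
    have hanti : ∀ {V W : Submodule k A}, V ≤ W → openAnnihilator W ≤ openAnnihilator V :=
      fun hVW f hf => mem_openAnnihilator.2 fun x hx => mem_openAnnihilator.1 hf x (hVW hx)
    rcases hc.total hV hW with hVW | hVW
    · exact ⟨_, ⟨V, hV, rfl⟩, le_rfl, hanti hVW⟩
    · exact ⟨_, ⟨W, hW, rfl⟩, hanti hVW, le_rfl⟩
  refine eq_top_iff.2 fun a _ => ?_
  obtain ⟨x, y, rfl, hx, hy⟩ := exists_add_of_forall_mem_inf (sSup (openAnnihilator '' c))
    (openAnnihilator J) (a := a) fun f hf => by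
      obtain ⟨_, ⟨W, hW, rfl⟩, hfW⟩ := (Submodule.mem_sSup_of_directed (hne.image _) hdir).1 hf.1
      obtain ⟨y, hy, z, hz, rfl⟩ := Submodule.mem_sup.1
        (show a ∈ W ⊔ J from h W hW ▸ Submodule.mem_top)
      rw [map_add, mem_openAnnihilator.1 hfW y hy, mem_openAnnihilator.1 hf.2 z hz, add_zero]
  refine Submodule.add_mem_sup (Submodule.mem_sInf.2 fun W hW => ?_)
    (mem_of_forall_mem_openAnnihilator hJ hy)
  exact mem_of_forall_mem_openAnnihilator (hcl W hW) fun f hf =>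

    hx f ((le_sSup (Set.mem_image_of_mem openAnnihilator hW) :
      openAnnihilator W ≤ sSup (openAnnihilator '' c)) hf)

end Duality

/-! ### Minimal closed subalgebras that supplement the radical -/

section Splitting

variable {k : Type u} {A : Type v} [Field k] [Ring A] [Algebra k A] [TopologicalSpace A]
  [IsTopologicalRing A] [IsPseudocompactAlgebra k A]

variable (k A) in
theorem isClosed_pseudocompactRadical : IsClosed (pseudocompactRadical k A : Set A) := by
  rw [pseudocompactRadical, Submodule.coe_sInf]
  exact isClosed_biInter fun M hM => hM.1.1

/-- The maximal left ideals of `A / I` pull back to maximal closed left ideals of `A`, so the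
radical of `A` maps into that of `A / I`. -/
theorem mk_mem_jacobson_of_mem_pseudocompactRadical {I : Ideal A} [I.IsTwoSided]
    (hI : IsOpen (I : Set A)) {x : A} (hx : x ∈ pseudocompactRadical k A) :
    Ideal.Quotient.mk I x ∈ Ring.jacobson (A ⧸ I) := by
  rw [Ring.jacobson_eq_sInf_isMaximal, Submodule.mem_sInf]
  intro (m : Ideal (A ⧸ I)) (hm : m.IsMaximal)
  have hmax : (Ideal.comap (Ideal.Quotient.mk I) m).IsMaximal :=
    Ideal.comap_isMaximal_of_surjective _ Ideal.Quotient.mk_surjective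
  have hopen : IsOpen ((Ideal.comap (Ideal.Quotient.mk I) m : Ideal A) : Set A) :=
    isOpen_of_le_ideal (fun y hy => by
      rw [Ideal.mem_comap, Ideal.Quotient.eq_zero_iff_mem.2 hy]
      exact zero_mem m) hI
  refine Submodule.mem_sInf.1 hx (Ideal.comap (Ideal.Quotient.mk I) m)
    ⟨⟨isClosed_of_isOpen_ideal hopen, hmax.ne_top⟩, fun N hN hle => ?_⟩
  exact (hmax.eq_of_le hN.2 hle).ge

/-- The closed subalgebras that span `A` together with the radical. -/
def IsClosedSupplement (S : Subalgebra k A) : Prop :=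
  IsClosed (S : Set A) ∧ S.toSubmodule ⊔ (pseudocompactRadical k A).restrictScalars k = ⊤

variable (k A) in
theorem exists_minimal_isClosedSupplement :
    ∃ S : Subalgebra k A, Minimal IsClosedSupplement S := by
  obtain ⟨S, hS⟩ := zorn_le₀ (α := (Subalgebra k A)ᵒᵈ)
    {S | IsClosedSupplement (OrderDual.ofDual S)} fun c hc hchain => by
    rcases c.eq_empty_or_nonempty with rfl | hne
    · refine ⟨OrderDual.toDual ⊤, ⟨?_, ?_⟩, by simp⟩
      · simp
      · simp
    · let c' : Set (Subalgebra k A) := OrderDual.toDual ⁻¹' c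
      have hne' : c'.Nonempty := hne
      refine ⟨OrderDual.toDual (sInf c'), ⟨?_, ?_⟩, fun S hS => ?_⟩
      · rw [OrderDual.ofDual_toDual, Algebra.coe_sInf]
        exact isClosed_biInter fun S hS => (hc hS).1
      · rw [OrderDual.ofDual_toDual, Algebra.sInf_toSubmodule]
        refine sInf_sup_eq_top_of_isChain ?_ (hne'.image _) ?_
          (isClosed_pseudocompactRadical k A) ?_
        · rintro _ ⟨S, hS, rfl⟩ _ ⟨T, hT, rfl⟩ _
          rcases hchain.total hS hT with h | h
          · exact Or.inr h
          · exact Or.inl h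
        · rintro _ ⟨S, hS, rfl⟩
          exact (hc hS).1
        · rintro _ ⟨S, hS, rfl⟩
          exact (hc hS).2
      · exact sInf_le (α := Subalgebra k A) hS
  exact ⟨OrderDual.ofDual S, hS.1, fun T hT hTS => hS.2 (y := OrderDual.toDual T) hT hTS⟩

/-- The projection to `A / J` restricted to a subalgebra. -/
noncomputable def residueMap (S : Subalgebra k A) : S →ₐ[k] A ⧸ pseudocompactRadical k A :=
  (Ideal.Quotient.mkₐ k (pseudocompactRadical k A)).comp S.val

theorem residueMap_eq_zero_iff {S : Subalgebra k A} {x : S} :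
    residueMap S x = 0 ↔ (x : A) ∈ pseudocompactRadical k A :=
  Ideal.Quotient.eq_zero_iff_mem

namespace IsClosedSupplement

variable {S : Subalgebra k A}

theorem residueMap_surjective (hS : IsClosedSupplement S) :
    Function.Surjective (residueMap S) := by
  intro y
  obtain ⟨a, rfl⟩ := Ideal.Quotient.mk_surjective y
  obtain ⟨s, hs, j, hj, rfl⟩ := Submodule.mem_sup.1
    (show a ∈ _ from hS.2 ▸ Submodule.mem_top)
  refine ⟨⟨s, hs⟩, ?_⟩
  rw [map_add, Ideal.Quotient.eq_zero_iff_mem.2 hj, add_zero]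
  rfl

/-- If `S` is a closed supplement of the radical `J` and `I` is open of finite codimension, then
`(S ∩ I) + J` is open, being closed and of finite codimension. -/
theorem isOpen_inf_sup (hS : IsClosedSupplement S) {I : Ideal A} [I.IsTwoSided]
    (hI : IsOpen (I : Set A)) [FiniteDimensional k (A ⧸ I)] :
    IsOpen (((S.toSubmodule ⊓ I.restrictScalars k) ⊔
      (pseudocompactRadical k A).restrictScalars k : Submodule k A) : Set A) := by
  set W : Submodule k A := (S.toSubmodule ⊓ I.restrictScalars k) ⊔
      (pseudocompactRadical k A).restrictScalars k with hW
  have hcl : IsClosed (W : Set A) :=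
    isClosed_sup (hS.1.inter (isClosed_of_isOpen_ideal hI)) (isClosed_pseudocompactRadical k A)
  let φ : S.toSubmodule →ₗ[k] A ⧸ I :=
    (Ideal.Quotient.mkₐ k I).toLinearMap ∘ₗ S.toSubmodule.subtype
  have hker : LinearMap.ker φ ≤ LinearMap.ker (W.mkQ ∘ₗ S.toSubmodule.subtype) := by
    intro x hx
    have hxI : (x : A) ∈ I := Ideal.Quotient.eq_zero_iff_mem.1 hx
    exact (Submodule.Quotient.mk_eq_zero W).2 (Submodule.mem_sup_left ⟨x.2, hxI⟩)
  have hfin : FiniteDimensional k (S.toSubmodule ⧸ LinearMap.ker φ) :=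
    φ.quotKerEquivRange.symm.finiteDimensional
  have hsurj : Function.Surjective
      ((LinearMap.ker φ).liftQ (W.mkQ ∘ₗ S.toSubmodule.subtype) hker) := by
    intro y
    obtain ⟨a, rfl⟩ := W.mkQ_surjective y
    obtain ⟨s, hs, j, hj, rfl⟩ := Submodule.mem_sup.1
      (show a ∈ _ from hS.2 ▸ Submodule.mem_top)
    refine ⟨(LinearMap.ker φ).mkQ ⟨s, hs⟩, ?_⟩
    have hjW : W.mkQ j = 0 := (Submodule.Quotient.mk_eq_zero W).2 (Submodule.mem_sup_right hj)
    rw [map_add, hjW, add_zero]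
    rfl
  have : FiniteDimensional k (A ⧸ W) := Module.Finite.of_surjective _ hsurj
  exact isOpen_of_isClosed_of_finiteDimensional hcl

/-- The residue map of a closed supplement is open: it maps the open ideals to open ideals. -/
theorem isOpen_image_residueMap (hS : IsClosedSupplement S) {I : Ideal A} [I.IsTwoSided]
    (hI : IsOpen (I : Set A)) [FiniteDimensional k (A ⧸ I)] :
    IsOpen (residueMap S '' {x | (x : A) ∈ I}) := by
  have h := (pseudocompactRadical k A).isOpenQuotientMap_mkQ.isOpenMap _ (hS.isOpen_inf_sup hI)
  convert h using 1
  ext y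
  constructor
  · rintro ⟨x, hx, rfl⟩
    exact ⟨x, Submodule.mem_sup_left ⟨x.2, hx⟩, rfl⟩
  · rintro ⟨a, ha, rfl⟩
    obtain ⟨s, hs, j, hj, rfl⟩ := Submodule.mem_sup.1 ha
    refine ⟨⟨s, hs.1⟩, hs.2, ?_⟩
    have h0 : (pseudocompactRadical k A).mkQ j = 0 := (Submodule.Quotient.mk_eq_zero _).2 hj
    rw [map_add, h0, add_zero]
    rfl

end IsClosedSupplement

/-- The finite-dimensional step: `S / (S ∩ I)` has a nilpotent ideal, the image of `S ∩ J`, with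
separable quotient. A splitting of this quotient pulls back to a closed supplement of `J` inside
`S`, so for minimal `S` the splitting is all of `S / (S ∩ I)` and the ideal vanishes. -/
theorem mem_of_minimal_isClosedSupplement
    (hsep : IsSeparablePseudocompact k (A ⧸ pseudocompactRadical k A)) {S : Subalgebra k A}
    (hS : Minimal IsClosedSupplement S) {I : Ideal A} [I.IsTwoSided] (hI : IsOpen (I : Set A))
    [FiniteDimensional k (A ⧸ I)] {x : A} (hxS : x ∈ S) (hxJ : x ∈ pseudocompactRadical k A) :
    x ∈ I := by
  have hsurj := hS.1.residueMap_surjective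
  let IS : Ideal S := Ideal.comap S.val I
  have : IS.IsTwoSided := inferInstanceAs (Ideal.comap S.val.toRingHom I).IsTwoSided
  let K : Ideal (A ⧸ pseudocompactRadical k A) := Ideal.map (residueMap S) IS
  have hK : ∀ y, y ∈ K ↔ ∃ s ∈ IS, residueMap S s = y := fun y =>
    Ideal.mem_map_iff_of_surjective (residueMap S) hsurj
  have hKtwo : K.IsTwoSided := ⟨fun {a} b ha => by
    obtain ⟨s, hs, rfl⟩ := (hK a).1 ha
    obtain ⟨t, rfl⟩ := hsurj b
    exact (hK _).2 ⟨s * t, IS.mul_mem_right t hs, map_mul _ _ _⟩⟩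
  have hKopen : IsOpen (K : Set (A ⧸ pseudocompactRadical k A)) := by
    convert hS.1.isOpen_image_residueMap hI using 1
    ext y
    exact hK y
  -- the embedding of `C = S / (S ∩ I)` in `A / I`
  let ι : S ⧸ IS →ₐ[k] A ⧸ I := Ideal.Quotient.liftₐ IS ((Ideal.Quotient.mkₐ k I).comp S.val)
    fun s hs => Ideal.Quotient.eq_zero_iff_mem.2 hs
  have hι : Function.Injective ι := by
    refine (injective_iff_map_eq_zero ι).2 fun c hc => ?_
    obtain ⟨s, rfl⟩ := Ideal.Quotient.mk_surjective c
    exact Ideal.Quotient.eq_zero_iff_mem.2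
      (show (s : A) ∈ I from Ideal.Quotient.eq_zero_iff_mem.1 hc)
  -- the projection of `C` onto `D = (A / J) / K`
  let π : S ⧸ IS →ₐ[k] (A ⧸ pseudocompactRadical k A) ⧸ K :=
    Ideal.Quotient.liftₐ IS ((Ideal.Quotient.mkₐ k K).comp (residueMap S))
      fun s hs => Ideal.Quotient.eq_zero_iff_mem.2 ((hK _).2 ⟨s, hs, rfl⟩)
  have hπmk : ∀ s : S, π (Ideal.Quotient.mk IS s) = Ideal.Quotient.mk K (residueMap S s) :=
    fun s => rfl
  have hπsurj : Function.Surjective π := by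
    intro y
    obtain ⟨y, rfl⟩ := Ideal.Quotient.mk_surjective y
    obtain ⟨s, rfl⟩ := hsurj y
    exact ⟨Ideal.Quotient.mk IS s, rfl⟩
  have hπker : ∀ s : S, π (Ideal.Quotient.mk IS s) = 0 →
      ∃ t ∈ IS, ((s - t : S) : A) ∈ pseudocompactRadical k A := by
    intro s hs
    rw [hπmk, Ideal.Quotient.eq_zero_iff_mem, hK] at hs
    obtain ⟨t, ht, hts⟩ := hs
    exact ⟨t, ht, residueMap_eq_zero_iff.1 (by rw [map_sub, hts, sub_self])⟩
  have hfinC : FiniteDimensional k (S ⧸ IS) :=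
    FiniteDimensional.of_injective ι.toLinearMap hι
  have hfinD : FiniteDimensional k ((A ⧸ pseudocompactRadical k A) ⧸ K) :=
    Module.Finite.of_surjective π.toLinearMap hπsurj
  have hnil : IsNilpotent (RingHom.ker π) := by
    have : IsArtinianRing (A ⧸ I) := IsArtinianRing.of_finite k (A ⧸ I)
    obtain ⟨n, hn⟩ := isNilpotent_comap_of_injective (f := ι.toRingHom) hι
      (IsSemiprimaryRing.isNilpotent (R := A ⧸ I))
    refine ⟨n, le_bot_iff.1 (le_trans (Ideal.pow_right_mono ?_ n) hn.le)⟩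
    intro c hc
    obtain ⟨s, rfl⟩ := Ideal.Quotient.mk_surjective c
    obtain ⟨t, ht, hst⟩ := hπker s hc
    have h1 : (Ideal.Quotient.mk IS s) = Ideal.Quotient.mk IS (s - t) := by
      rw [map_sub, Ideal.Quotient.eq_zero_iff_mem.2 ht, sub_zero]
    rw [h1]
    exact mk_mem_jacobson_of_mem_pseudocompactRadical hI hst
  obtain ⟨σ, hσ⟩ := (hsep.hasSeparabilityIdempotent
    ⟨K, hKtwo, hKopen⟩).exists_algHom_section π hπsurj hnil
  -- the pullback of the image of the splitting
  let T : Subalgebra k S := σ.range.comap (Ideal.Quotient.mkₐ k IS)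
  have hTopen : IsOpen (T : Set S) := by
    refine AddSubgroup.isOpen_mono (H₁ := IS.toAddSubgroup)
      (H₂ := T.toSubmodule.toAddSubgroup) (fun s hs => ?_) (hI.preimage continuous_subtype_val)
    change Ideal.Quotient.mk IS s ∈ σ.range
    rw [Ideal.Quotient.eq_zero_iff_mem.2 hs]
    exact zero_mem _
  have hT : IsClosedSupplement (T.map S.val) := by
    constructor
    · have hTcl : IsClosed (T : Set S) :=
        AddSubgroup.isClosed_of_isOpen T.toSubmodule.toAddSubgroup hTopen
      exact hS.1.1.isClosedEmbedding_subtypeVal.isClosedMap _ hTcl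
    · refine eq_top_iff.2 fun a _ => ?_
      obtain ⟨s, hs, j, hj, rfl⟩ := Submodule.mem_sup.1
        (show a ∈ _ from hS.1.2 ▸ Submodule.mem_top)
      obtain ⟨t, ht⟩ := Ideal.Quotient.mk_surjective (σ (π (Ideal.Quotient.mk IS ⟨s, hs⟩)))
      obtain ⟨r, hr, hj'⟩ := hπker (⟨s, hs⟩ - t) (by rw [map_sub, map_sub, ht, hσ, sub_self])
      refine Submodule.mem_sup.2 ⟨((t + r : S) : A), ⟨t + r, ?_, rfl⟩,
        ((⟨s, hs⟩ - t - r : S) : A) + j, add_mem hj' hj, ?_⟩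
      · change Ideal.Quotient.mk IS (t + r) ∈ σ.range
        rw [map_add, Ideal.Quotient.eq_zero_iff_mem.2 hr, add_zero, ht]
        exact ⟨_, rfl⟩
      · push_cast
        abel
  have hle : S ≤ T.map S.val := hS.2 hT fun y hy => by
    obtain ⟨t, -, rfl⟩ := hy
    exact t.2
  obtain ⟨t, ⟨d, hd⟩, rfl⟩ := hle hxS
  have hd : σ d = Ideal.Quotient.mk IS t := hd
  have h0 : π (Ideal.Quotient.mk IS t) = 0 := by
    rw [hπmk, residueMap_eq_zero_iff.2 hxJ, map_zero]
  rw [← hd, hσ] at h0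
  rw [h0, map_zero] at hd
  have h1 : t ∈ IS := Ideal.Quotient.eq_zero_iff_mem.1 hd.symm
  exact h1

end Splitting

theorem mainTheorem1 {k : Type u} {A : Type v} [Field k] [Ring A] [Algebra k A]
    [TopologicalSpace A] [IsTopologicalRing A] [IsPseudocompactAlgebra k A]
    (hsep : IsSeparablePseudocompact k (A ⧸ pseudocompactRadical k A)) :
    ∃ s : (A ⧸ pseudocompactRadical k A) →ₐ[k] A,
      Continuous s ∧
      (Ideal.Quotient.mkₐ k (pseudocompactRadical k A)).comp s = AlgHom.id k _ ∧
      IsClosed (s.range : Set A) ∧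
      IsCompl (Subalgebra.toSubmodule s.range)
        ((pseudocompactRadical k A).restrictScalars k) := by
  obtain ⟨S, hS⟩ := exists_minimal_isClosedSupplement k A
  have hdisj : ∀ x ∈ S, x ∈ pseudocompactRadical k A → x = 0 := fun x hxS hxJ =>
    IsPseudocompactAlgebra.eq_zero_of_forall_mem (k := k) x fun I _ hI _ =>
      mem_of_minimal_isClosedSupplement hsep hS hI hxS hxJ
  have hbij : Function.Bijective (residueMap S) := by
    refine ⟨(injective_iff_map_eq_zero _).2 fun x hx => ?_, hS.1.residueMap_surjective⟩
    exact Subtype.ext (hdisj x x.2 (residueMap_eq_zero_iff.1 hx))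
  let φ : S ≃ₐ[k] A ⧸ pseudocompactRadical k A := AlgEquiv.ofBijective (residueMap S) hbij
  have hφ : ∀ y, residueMap S (φ.symm y) = y := φ.apply_symm_apply
  have hrange : (S.val.comp φ.symm.toAlgHom).range = S := by
    ext x
    constructor
    · rintro ⟨y, rfl⟩
      exact (φ.symm y).2
    · intro hx
      exact ⟨φ ⟨x, hx⟩, by simp⟩
  refine ⟨S.val.comp φ.symm.toAlgHom, ?_, ?_, ?_, ?_⟩
  · refine continuous_of_continuousAt_zero (S.val.comp φ.symm.toAlgHom) ?_
    rw [ContinuousAt, map_zero,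
      (IsPseudocompactAlgebra.hasBasis_nhds_zero (k := k) (A := A)).tendsto_right_iff]
    rintro I ⟨_, hI, hfin⟩
    filter_upwards [(hS.1.isOpen_image_residueMap hI).mem_nhds ⟨0, zero_mem I, map_zero _⟩]
    rintro _ ⟨x, hx, rfl⟩
    have : φ.symm (residueMap S x) = x := φ.symm_apply_apply x
    simpa [this] using hx
  · ext y
    exact hφ y
  · rw [hrange]
    exact hS.1.1
  · rw [hrange, isCompl_iff, codisjoint_iff, Submodule.disjoint_def]
    exact ⟨hdisj, hS.1.2⟩
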